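/- **Theorem (unidirectional circle patrolling).** Consider $k$ mobile agents with speed limits $v_1, \ldots, v_k$ on a circle of perimeter $L>0$, identified with $\mathbb{R}/L\mathbb{Z}$ so that the positive direction is clockwise. A (clockwise-only) schedule is a $k$-tuple of trajectories $a_1,\dots,a_k\colon \mathbb{R}\to\mathbb{R}/L\mathbb{Z}$ such that each agent moves only clockwise, at speed between $0$ and its speed limit; that is, each $a_i$ has a lift $f_i\colon\mathbb{R}\to\mathbb{R}$ with $0\le f_i(t)-f_i(s)\le v_i\,(t-s)$ for all $s\le t$. The schedule patrols the circle if for every point $x$ of the circle and every time $t\in\mathbb{R}$ there are an agent $i$ and a time $t'\in[t,t+1)$ with $a_i(t')=x$. There exist an integer $k\ge 1$, speed limits $v_1\ge v_2\ge\cdots\ge v_k>0$, and a schedule (for agents with these speed limits) that patrols the circle of perimeter $$L = 1.05\cdot\max_{1\le r\le k} r\,v_r .$$ (The perimeter $\max_r r v_r$ is the one achieved by the runners strategy, in which the $r$ fastest agents move equidistantly at the constant speed $v_r$, for the best choice of $r$.) -/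

import Mathlib

namespace CirclePatrolling

/-- `IsClockwiseMotion L v a`: the trajectory `a : ℝ → AddCircle L` (time to position on the circle
of perimeter `L`, where the positive direction is clockwise) moves only clockwise, at a speed that
is always between `0` and `v`. The function `f` is the trajectory unrolled onto the real line. -/
def IsClockwiseMotion (L v : ℝ) (a : ℝ → AddCircle L) : Prop :=
  ∃ f : ℝ → ℝ, (∀ t, a t = (f t : AddCircle L)) ∧
    ∀ s t, s ≤ t → 0 ≤ f t - f s ∧ f t - f s ≤ v * (t - s)

/-- The trajectories `a i` patrol the circle of perimeter `L` (with idle time `1`): every point of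
the circle is visited by some agent during every time interval `[t, t + 1)`, `t ∈ ℝ`. -/
def Patrols {k : ℕ} (L : ℝ) (a : Fin k → ℝ → AddCircle L) : Prop :=
  ∀ (x : AddCircle L) (t : ℝ), ∃ i, ∃ t' ∈ Set.Ico t (t + 1), a i t' = x

/-- `k` agents with speed limits `v` that move only clockwise can patrol a circle of
perimeter `L`. -/
def CanPatrolCircle {k : ℕ} (v : Fin k → ℝ) (L : ℝ) : Prop :=
  ∃ a : Fin k → ℝ → AddCircle L, (∀ i, IsClockwiseMotion L (v i) (a i)) ∧ Patrols L a

/-- The perimeter `max_{1 ≤ r ≤ k} r v_r` achieved by the runners strategy for speed limits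
`v_1 ≥ ⋯ ≥ v_k`. The speed limit `v_r` is `v r'` with `r' = r - 1` in `Fin k`; for `k ≥ 1` the
supremum is over a finite nonempty family, hence a maximum. -/
noncomputable def runnersPerimeter {k : ℕ} (v : Fin k → ℝ) : ℝ :=
  ⨆ r : Fin k, ((r : ℕ) + 1 : ℝ) * v r

end CirclePatrolling

namespace CirclePatrolling

/-! Speed limits `1, 1/2, …, 1/8` make every `r * v r` equal to `1`, so it suffices to patrol
perimeter `21 / 20`. The leader runs steadily at speed `1` and leaves each point unvisited for `1 /
20` too long per lap. By `patrols_of_leader`, this is repaired if after each leader visit, at time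
`u`, someone visits that point in `[u + 1/20, u + 1]`. An agent of speed `1 / (i + 1)` can stay in
this moving window for a distance of `19 / i` twentieths, then waits or moves to its next stretch. A
schedule of period `164 / 20`, tabulated in `waypoints`, makes such full-speed legs cover the
leader's whole path. `legs_spec` and `guard_spec` check the table in integers;
`exists_isLift_periodic` turns it into motions. -/

/-- `f` is the unrolled trajectory of an agent moving only clockwise with speed limit `v`. -/
def IsLift (v : ℝ) (f : ℝ → ℝ) : Prop :=
  ∀ s t, s ≤ t → 0 ≤ f t - f s ∧ f t - f s ≤ v * (t - s)

/-- A motion that covers a distance in the shortest possible time moves at full speed. -/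
lemma IsLift.eq_of_full_speed {v : ℝ} {f : ℝ → ℝ} (hf : IsLift v f) {α β t : ℝ}
    (h : f β - f α = v * (β - α)) (hα : α ≤ t) (hβ : t ≤ β) : f t = f α + v * (t - α) := by
  have h₁ := (hf α t hα).2
  have h₂ := (hf t β hβ).2
  linarith

/-- Waypoints whose successive distances respect the speed limit can be interpolated. -/
lemma exists_isLift_interpolating {v : ℝ} (hv : 0 ≤ v) (τ p : ℤ → ℝ)
    (hp : ∀ j, p j ≤ p (j + 1)) (hτ : ∀ j, p (j + 1) - p j ≤ v * (τ (j + 1) - τ j)) :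
    ∃ f, IsLift v f ∧ ∀ j, f (τ j) = p j := by
  have hmono : Monotone p := monotone_int_of_le_succ hp
  have hanti : Antitone fun j => p j - v * τ j :=
    antitone_int_of_succ_le fun j => by have := hτ j; linarith
  -- Any motion through waypoint `i` lies above this `min`, and any through waypoint `j` below this
  -- `max`. The supremum of the lower bounds is the witness.
  have hle : ∀ i j t, min (p i) (p i + v * (t - τ i)) ≤ max (p j) (p j + v * (t - τ j)) := by
    intro i j t
    rcases le_total i j with h | h
    · exact (min_le_left _ _).trans ((hmono h).trans (le_max_left _ _))
    · refine (min_le_right _ _).trans (le_trans ?_ (le_max_right _ _))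
      have := hanti h
      dsimp only at this
      linarith
  have hbdd : ∀ t, BddAbove (Set.range fun i => min (p i) (p i + v * (t - τ i))) := fun t =>
    ⟨max (p 0) (p 0 + v * (t - τ 0)), by rintro _ ⟨i, rfl⟩; exact hle i 0 t⟩
  refine ⟨fun t => ⨆ i, min (p i) (p i + v * (t - τ i)), fun s t hst => ⟨?_, ?_⟩, fun j => ?_⟩
  · refine sub_nonneg.2 (ciSup_mono (hbdd t) fun i => min_le_min le_rfl ?_)
    have := mul_le_mul_of_nonneg_left hst hv
    linarith
  · refine sub_le_iff_le_add.2 (ciSup_le fun i => ?_)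
    have h₁ := le_ciSup (hbdd s) i
    have h₂ := mul_nonneg hv (sub_nonneg.2 hst)
    refine le_trans ?_ (add_le_add le_rfl h₁)
    rw [← min_add_add_left]
    refine min_le_min (by linarith) (by linarith)
  · refine le_antisymm (ciSup_le fun i => by simpa using hle i j (τ j)) ?_
    simpa using le_ciSup (hbdd (τ j)) j

/-- Finitely many waypoints, repeated with time period `T` and displacement `Q`, can be
interpolated. -/
lemma exists_isLift_periodic {v : ℝ} (hv : 0 ≤ v) {N : ℕ} (hN : 0 < N) (τ p : ℕ → ℝ) (T Q : ℝ)
    (hp : ∀ m < N, p m ≤ p (m + 1)) (hτ : ∀ m < N, p (m + 1) - p m ≤ v * (τ (m + 1) - τ m))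
    (hT : τ N = τ 0 + T) (hQ : p N = p 0 + Q) :
    ∃ f, IsLift v f ∧ ∀ m ≤ N, ∀ n : ℤ, f (τ m + n * T) = p m + n * Q := by
  -- Euclidean division of the index by `N` splits it into a waypoint and a period.
  let ext (g : ℕ → ℝ) (S : ℝ) (j : ℤ) : ℝ := g (j % N).toNat + (j / N : ℤ) * S
  have hlt : ∀ (g : ℕ → ℝ) (S : ℝ) (n : ℤ), ∀ m < N, ext g S (m + n * N) = g m + n * S := by
    intro g S n m hm
    have hN' : (N : ℤ) ≠ 0 := by omega
    have h₁ : ((m : ℤ) + n * N) % N = m := by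
      rw [Int.add_mul_emod_self_right, Int.emod_eq_of_lt (by omega) (by omega)]
    have h₂ : ((m : ℤ) + n * N) / N = n := by
      rw [Int.add_mul_ediv_right _ _ hN', Int.ediv_eq_zero_of_lt (by omega) (by omega), zero_add]
    simp only [ext, h₁, h₂, Int.toNat_natCast]
  have hle : ∀ (g : ℕ → ℝ) (S : ℝ), g N = g 0 + S → ∀ (n : ℤ), ∀ m ≤ N,
      ext g S (m + n * N) = g m + n * S := by
    intro g S hS n m hm
    rcases hm.lt_or_eq with hm | rfl
    · exact hlt g S n m hm
    · have := hlt g S (n + 1) 0 hN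
      rw [show ((m : ℕ) : ℤ) + n * m = ((0 : ℕ) : ℤ) + (n + 1) * m by push_cast; ring, this, hS]
      push_cast
      ring
  have hdecomp : ∀ j : ℤ, ∃ m < N, ∃ n : ℤ, j = m + n * N := fun j =>
    ⟨(j % N).toNat, by have := Int.emod_lt_of_pos j (b := N) (by omega); omega, j / N, by
      rw [Int.toNat_of_nonneg (Int.emod_nonneg _ (by omega)), mul_comm, Int.emod_add_mul_ediv]⟩
  obtain ⟨f, hf, hfτ⟩ := exists_isLift_interpolating hv (ext τ T) (ext p Q)
    (fun j => by
      obtain ⟨m, hm, n, rfl⟩ := hdecomp j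
      rw [show (m : ℤ) + n * N + 1 = ((m + 1 : ℕ) : ℤ) + n * N by push_cast; ring,
        hle p Q hQ n m hm.le, hle p Q hQ n (m + 1) hm]
      have := hp m hm
      linarith)
    (fun j => by
      obtain ⟨m, hm, n, rfl⟩ := hdecomp j
      rw [show (m : ℤ) + n * N + 1 = ((m + 1 : ℕ) : ℤ) + n * N by push_cast; ring,
        hle p Q hQ n m hm.le, hle p Q hQ n (m + 1) hm, hle τ T hT n m hm.le,
        hle τ T hT n (m + 1) hm]
      have := hτ m hm
      linarith)
  refine ⟨f, hf, fun m hm n => ?_⟩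
  have := hfτ (m + n * N)
  rwa [hle τ T hT n m hm, hle p Q hQ n m hm] at this

/-- If one agent goes around the circle at speed `1` and, between any two of its visits to a point,
some agent visits that point too, with no waiting time above `1`, then the circle is patrolled. -/
lemma patrols_of_leader {k : ℕ} {L : ℝ} (hL : 0 < L) (F : Fin k → ℝ → ℝ) (i₀ : Fin k)
    (h₀ : ∀ t, F i₀ t = t)
    (h : ∀ u, ∃ i, ∃ t ∈ Set.Icc (u + (L - 1)) (u + 1), (F i t : AddCircle L) = (u : AddCircle L)) :
    Patrols L fun i t => (F i t : AddCircle L) := by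
  intro x t
  have : Fact (0 < L) := ⟨hL⟩
  obtain ⟨⟨y, hy⟩, rfl⟩ := (AddCircle.equivIco L t).symm.surjective x
  change ∃ i, ∃ t' ∈ Set.Ico t (t + 1), (F i t' : AddCircle L) = (y : AddCircle L)
  rcases lt_or_ge y (t + 1) with hlt | hge
  · exact ⟨i₀, y, ⟨hy.1, hlt⟩, by rw [h₀]⟩
  -- The leader's previous visit to the point was at time `y - L`.
  · obtain ⟨i, t', ht', hF⟩ := h (y - L)
    refine ⟨i, t', ⟨by linarith [ht'.1], by linarith [ht'.2, hy.2]⟩, hF.trans ?_⟩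
    rw [AddCircle.coe_sub, AddCircle.coe_period, sub_zero]

/-- The waypoints (time, position) of the agents following the leader during one period, in units
of `1 / 20`; the last waypoint of an agent repeats its first one, one period later. The position is
unrolled onto the real line. Agent `i` has speed limit `1 / (i + 1)`. -/
def waypoints (i : ℕ) : List (ℤ × ℤ) :=
  [[],
   [(22, 0), (60, 19), (64, 21), (102, 40), (104, 40), (142, 59), (148, 62), (184, 80), (186, 80)],
   [(4, 3), (31, 12), (55, 12), (82, 21), (86, 22), (113, 31), (138, 32), (165, 41), (168, 41)],
   [(16, 15), (40, 21), (48, 23), (68, 28), (98, 34), (122, 40), (125, 40), (149, 46), (180, 53)],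
   [(41, 19), (61, 23), (134, 28), (154, 32), (205, 36)],
   [(1, 0), (19, 3), (50, 7), (68, 10), (95, 10), (113, 13), (165, 17)],
   [(13, 12), (34, 15), (83, 19), (104, 22), (131, 25), (152, 28), (177, 29)],
   [(53, 10), (69, 12), (123, 17), (139, 19), (217, 27)]].getD i []

/-- The time of a waypoint. -/
def time (i m : ℕ) : ℤ := ((waypoints i).getD m (0, 0)).1

/-- The unrolled position of a waypoint. -/
def position (i m : ℕ) : ℤ := ((waypoints i).getD m (0, 0)).2

/-- The number of legs that agent `i` travels in one period. -/
def legs (i : ℕ) : ℕ := (waypoints i).length - 1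

/-- The distance that agent `i` travels in one period. -/
def advance (i : ℕ) : ℤ := position i (legs i) - position i 0

/-- Points dividing the path that the leader travels in one period. -/
def division (c : ℕ) : ℤ :=
  [0, 3, 12, 15, 21, 40, 44, 49, 52, 54, 63, 82, 85, 94, 97, 103, 122, 124, 130, 133, 137, 146,
    164].getD c 0

/-- The agent, and the index of the leg on its path, that takes care of the points between
`division c` and `division (c + 1)`. -/
def guard (c : ℕ) : ℕ × ℕ :=
  [(5, 0), (2, 0), (6, 0), (3, 0), (1, 0), (4, 0), (3, 2), (5, 2), (7, 0), (2, 2), (1, 2), (6, 2),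
    (2, 4), (5, 4), (3, 4), (1, 4), (7, 2), (3, 6), (6, 4), (4, 2), (2, 6), (1, 6)].getD c (0, 0)

/-- The divisibility by `21`, the perimeter in twentieths, says that over one period leader and
agent advance equally modulo full laps, so the pattern repeats relative to the leader. -/
lemma legs_spec : ∀ i < 8, 0 < i → 0 < legs i ∧ time i (legs i) = time i 0 + 164 ∧
    (21 : ℤ) ∣ 164 - advance i ∧
    ∀ m < legs i, position i m ≤ position i (m + 1) ∧
      (i + 1) * (position i (m + 1) - position i m) ≤ time i (m + 1) - time i m := by
  decide

/-- The window is checked only at the start and the end of each leg: a guard is slower than the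
leader, so it falls back steadily and stays inside in between. -/
lemma guard_spec : ∀ c < 22, 0 < (guard c).1 ∧ (guard c).1 < 8 ∧
    (guard c).2 < legs (guard c).1 ∧
    (21 : ℤ) ∣ division c - position (guard c).1 (guard c).2 ∧
    position (guard c).1 ((guard c).2 + 1) - position (guard c).1 (guard c).2 =
      division (c + 1) - division c ∧
    time (guard c).1 ((guard c).2 + 1) - time (guard c).1 (guard c).2 =
      ((guard c).1 + 1) * (division (c + 1) - division c) ∧
    division c + 1 ≤ time (guard c).1 (guard c).2 ∧
    time (guard c).1 ((guard c).2 + 1) ≤ division (c + 1) + 20 := by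
  decide

lemma exists_mem_division (y : ℝ) (hy : 0 ≤ y) : ∀ N : ℕ, y < division N →
    ∃ c < N, (division c : ℝ) ≤ y ∧ y < division (c + 1)
  | 0, h => absurd h (by simpa [division] using hy)
  | N + 1, h => by
    rcases lt_or_ge y (division N) with h' | h'
    · obtain ⟨c, hc, h⟩ := exists_mem_division y hy N h'
      exact ⟨c, by omega, h⟩
    · exact ⟨N, by omega, h', h⟩

lemma exists_agent (i : Fin 8) : ∃ f, IsLift (1 / ((i : ℕ) + 1 : ℝ)) f ∧
    ((i : ℕ) = 0 → ∀ t, f t = t) ∧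
    (0 < (i : ℕ) → ∀ m ≤ legs i, ∀ n : ℤ,
      f ((time i m : ℝ) / 20 + n * (164 / 20)) = position i m / 20 + n * (advance i / 20)) := by
  rcases Nat.eq_zero_or_pos (i : ℕ) with hi | hi
  · refine ⟨id, fun s t h => ?_, fun _ _ => rfl, fun h => absurd hi h.ne'⟩
    simp [hi, h]
  · obtain ⟨hN, hT, -, hstep⟩ := legs_spec i i.2 hi
    have hpos : (0 : ℝ) < (i : ℕ) + 1 := by positivity
    obtain ⟨f, hf, hfτ⟩ := exists_isLift_periodic (v := 1 / ((i : ℕ) + 1 : ℝ)) (by positivity) hN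
      (fun m => (time i m : ℝ) / 20) (fun m => (position i m : ℝ) / 20) (164 / 20)
      (advance i / 20)
      (fun m hm => by
        have := (hstep m hm).1
        have : (position i m : ℝ) ≤ position i (m + 1) := by exact_mod_cast this
        linarith)
      (fun m hm => by
        have := (hstep m hm).2
        have : ((i : ℕ) + 1 : ℝ) * (position i (m + 1) - position i m) ≤
          time i (m + 1) - time i m := by exact_mod_cast this
        rw [one_div, inv_mul_eq_div, le_div_iff₀ hpos]
        linarith)
      (by
        have : (time i (legs i) : ℝ) = time i 0 + 164 := by exact_mod_cast hT
        linarith)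
      (by simp only [advance]; push_cast; ring)
    exact ⟨f, hf, fun h => absurd h hi.ne', fun _ => hfτ⟩

/-- Eight agents with speed limits `1, 1/2, …, 1/8` patrol a circle of perimeter `21 / 20`. -/
lemma canPatrolCircle_harmonic :
    CanPatrolCircle (fun i : Fin 8 => 1 / ((i : ℕ) + 1 : ℝ)) (21 / 20) := by
  choose F hF h₀ hw using exists_agent
  refine ⟨fun i t => (F i t : AddCircle (21 / 20 : ℝ)), fun i => ⟨F i, fun _ => rfl, hF i⟩,
    patrols_of_leader (by norm_num) F 0 (h₀ 0 rfl) fun u => ?_⟩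
  obtain ⟨n, y, hy₀, hy₁, rfl⟩ :
      ∃ (n : ℤ) (y : ℝ), 0 ≤ y ∧ y < 164 ∧ u = y / 20 + n * (164 / 20) := by
    -- Reduce `u`, in twentieths, modulo the period `164`.
    refine ⟨⌊u * 20 / 164⌋, u * 20 - ⌊u * 20 / 164⌋ * 164, ?_, ?_, by ring⟩
    · linarith [Int.floor_le (u * 20 / 164)]
    · linarith [Int.lt_floor_add_one (u * 20 / 164)]
  obtain ⟨c, hc, hcy, hyc⟩ := exists_mem_division y hy₀ 22 (by norm_num [division]; exact hy₁)
  obtain ⟨hi₀, hi, hm, ⟨a, ha⟩, hlen, hdur, hbegin, hfinish⟩ := guard_spec c hc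
  generalize guard c = g at *
  obtain ⟨i, m⟩ := g
  dsimp only at *
  lift i to Fin 8 using hi
  obtain ⟨-, -, ⟨b, hb⟩, -⟩ := legs_spec i i.2 hi₀
  have ha' : (division c : ℝ) - position i m = 21 * a := by exact_mod_cast ha
  have hb' : (164 : ℝ) - advance i = 21 * b := by exact_mod_cast hb
  have hlen' : (position i (m + 1) : ℝ) - position i m = division (c + 1) - division c := by
    exact_mod_cast hlen
  have hdur' : (time i (m + 1) : ℝ) - time i m =
      ((i : ℕ) + 1) * (division (c + 1) - division c) := by exact_mod_cast hdur
  have hbegin' : (division c : ℝ) + 1 ≤ time i m := by exact_mod_cast hbegin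
  have hfinish' : (time i (m + 1) : ℝ) ≤ division (c + 1) + 20 := by exact_mod_cast hfinish
  have hpos : (0 : ℝ) ≤ (i : ℕ) := by positivity
  have hne : ((i : ℕ) + 1 : ℝ) ≠ 0 := by positivity
  have hlow := mul_nonneg hpos (sub_nonneg.2 hcy)
  have hupp := mul_nonneg hpos (sub_nonneg.2 hyc.le)
  -- The moment at which the guard, at full speed since the start of its leg, reaches the point.
  set t : ℝ := (time i m + ((i : ℕ) + 1) * (y - division c)) / 20 + n * (164 / 20) with ht
  have hFt : F i t = position i m / 20 + n * (advance i / 20) + (y - division c) / 20 := by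
    rw [(hF i).eq_of_full_speed (α := (time i m : ℝ) / 20 + n * (164 / 20))
      (β := (time i (m + 1) : ℝ) / 20 + n * (164 / 20)) ?_ ?_ ?_, hw i hi₀ m hm.le n, ht]
    · field_simp
      ring
    · rw [hw i hi₀ m hm.le n, hw i hi₀ (m + 1) hm n, one_div, inv_mul_eq_div, eq_div_iff hne]
      linear_combination ((i : ℕ) + 1 : ℝ) / 20 * hlen' - hdur' / 20
    · linarith
    · linarith
  refine ⟨i, t, ⟨by linarith, by linarith⟩, ?_⟩
  rw [hFt, ← sub_eq_zero, ← AddCircle.coe_sub, AddCircle.coe_eq_zero_iff]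
  -- Laps by which the guard's lift differs from the leader's: `a` at the start of the leg, `b` more
  -- for each period.
  refine ⟨-(a + n * b), ?_⟩
  rw [zsmul_eq_mul]
  push_cast
  linear_combination (1 / 20 : ℝ) * ha' + (n : ℝ) / 20 * hb'

lemma runnersPerimeter_harmonic :
    runnersPerimeter (fun i : Fin 8 => 1 / ((i : ℕ) + 1 : ℝ)) = 1 := by
  have h : ∀ i : Fin 8, ((i : ℕ) + 1 : ℝ) * (1 / ((i : ℕ) + 1 : ℝ)) = 1 := fun i =>
    mul_one_div_cancel (by positivity)
  simp only [runnersPerimeter, h, ciSup_const]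

end CirclePatrolling

theorem mainTheorem3 :
    ∃ (k : ℕ) (v : Fin k → ℝ), 0 < k ∧ (∀ i, 0 < v i) ∧ Antitone v ∧
      CirclePatrolling.CanPatrolCircle v (1.05 * CirclePatrolling.runnersPerimeter v) := by
  refine ⟨8, fun i => 1 / ((i : ℕ) + 1 : ℝ), by norm_num, fun i => by positivity,
    fun i j hij => ?_, ?_⟩
  · have : ((i : ℕ) : ℝ) ≤ (j : ℕ) := by exact_mod_cast hij
    exact one_div_le_one_div_of_le (by positivity) (by linarith)
  · rw [CirclePatrolling.runnersPerimeter_harmonic,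
      show (1.05 * 1 : ℝ) = 21 / 20 by norm_num]
    exact CirclePatrolling.canPatrolCircle_harmonic
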